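/- For $R>0$ let $\Gamma_R=\{\lambda\in\mathbb Z^2 : R-\tfrac1{\sqrt2}<\|\lambda\|<R+\tfrac1{\sqrt2}\}$, a finite nonempty set, and let $G=[-\tfrac1{\sqrt2},\tfrac1{\sqrt2}]\times[0,2\pi)$. Identifying $\mathbb R^2$ with $\mathbb C$, write each $\lambda\in\Gamma_R$ in shifted polar coordinates $\lambda=(R+r_\lambda)e^{i\theta_\lambda}$ with $R+r_\lambda=\|\lambda\|$ and $(r_\lambda,\theta_\lambda)\in G$ (with $\theta_\lambda:=0$ if $\lambda=0$, which can occur only for $R<\tfrac1{\sqrt2}$). Then, as $R\to\infty$ through the positive reals, the random vectors $(r_\lambda,\theta_\lambda)$, where $\lambda$ is drawn uniformly from $\Gamma_R$, converge in distribution to the uniform random vector on $G$, i.e. to the vector whose law is the probability measure $\frac{dr\,d\theta}{\sqrt8\,\pi}$ on $G$. -/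

import Mathlib

open MeasureTheory ProbabilityTheory Filter Topology

noncomputable section

namespace CircleLattice

/-- The lattice point `p ∈ ℤ²`, seen in `ℂ ≅ ℝ²`. -/
def toC (p : ℤ × ℤ) : ℂ := ⟨(p.1 : ℝ), (p.2 : ℝ)⟩

/-- The set `Γ_R` of the lattice points in the open annulus
`{z : R - 1/√2 < ‖z‖ < R + 1/√2}`. -/
def annulusPoints (R : ℝ) : Set (ℤ × ℤ) :=
  {p | R - 1 / √2 < ‖toC p‖ ∧ ‖toC p‖ < R + 1 / √2}

/-- The rectangle `G = [-1/√2, 1/√2] × [0, 2π)`. -/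
def rectG : Set (ℝ × ℝ) :=
  Set.Icc (-(1 / √2)) (1 / √2) ×ˢ Set.Ico 0 (2 * Real.pi)

/-- The shifted polar coordinates `(r, θ)` of a lattice point: `r` is the modulus minus `R`, and
`θ` is the representative in `[0, 2π)` of the argument. -/
def shiftedPolar (R : ℝ) (p : ℤ × ℤ) : ℝ × ℝ :=
  (‖toC p‖ - R, toIcoMod Real.two_pi_pos 0 (toC p).arg)

/-- The probability measure `dr dθ / (√8 π)` on `G`, as a measure on `ℝ × ℝ`. -/
def unifG : Measure (ℝ × ℝ) :=
  ENNReal.ofReal (1 / (√8 * Real.pi)) • (volume : Measure (ℝ × ℝ)).restrict rectG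

/-- The shifted polar coordinates of a point of `Γ_R` lie in `G`. -/
theorem shiftedPolar_mem {R : ℝ} {p : ℤ × ℤ} (hp : p ∈ annulusPoints R) :
    shiftedPolar R p ∈ rectG := by
  obtain ⟨h1, h2⟩ := hp
  refine ⟨⟨?_, ?_⟩, ?_⟩
  · simp only [shiftedPolar]; linarith
  · simp only [shiftedPolar]; linarith
  · simpa [shiftedPolar] using toIcoMod_mem_Ico Real.two_pi_pos 0 (toC p).arg

/-- The defining relation `λ = (R + r) e^{iθ}` of the shifted polar coordinates. -/
theorem shiftedPolar_spec (R : ℝ) (p : ℤ × ℤ) :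
    toC p = ((R + (shiftedPolar R p).1 : ℝ) : ℂ) *
      Complex.exp (((shiftedPolar R p).2 : ℂ) * Complex.I) := by
  have h : Complex.exp (((shiftedPolar R p).2 : ℂ) * Complex.I) =
      Complex.exp (((toC p).arg : ℂ) * Complex.I) := by
    rw [Complex.exp_eq_exp_iff_exists_int]
    refine ⟨-toIcoDiv Real.two_pi_pos 0 (toC p).arg, ?_⟩
    simp only [shiftedPolar, toIcoMod]
    push_cast [zsmul_eq_mul]
    ring
  rw [h]
  have h2 : R + (shiftedPolar R p).1 = ‖toC p‖ := by simp [shiftedPolar]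
  rw [h2, Complex.norm_mul_exp_arg_mul_I]

theorem annulusPoints_finite (R : ℝ) : (annulusPoints R).Finite := by
  obtain ⟨N, hN⟩ := exists_nat_gt (R + 1 / √2)
  refine ((Set.finite_Icc (-(N : ℤ)) N).prod (Set.finite_Icc (-(N : ℤ)) N)).subset ?_
  rintro p ⟨-, h⟩
  have a := abs_le.1 ((Complex.abs_re_le_norm (toC p)).trans (h.trans hN).le)
  have b := abs_le.1 ((Complex.abs_im_le_norm (toC p)).trans (h.trans hN).le)
  simp only [toC] at a b
  exact ⟨⟨by exact_mod_cast a.1, by exact_mod_cast a.2⟩,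
    ⟨by exact_mod_cast b.1, by exact_mod_cast b.2⟩⟩

theorem annulusPoints_nonempty {R : ℝ} (hR : 0 < R) : (annulusPoints R).Nonempty := by
  have hs : (1 : ℝ) / 2 < 1 / √2 :=
    one_div_lt_one_div_of_lt (by positivity)
      (by rw [Real.sqrt_lt' (by norm_num)]; norm_num)
  refine ⟨(round R, 0), ?_⟩
  have hr := abs_le.1 (abs_sub_round R)
  have h0 : (0 : ℝ) ≤ (round R : ℝ) := by
    have : (-1 : ℝ) < (round R : ℝ) := by linarith [hr.2]
    have h' : (-1 : ℤ) < round R := by exact_mod_cast this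
    exact_mod_cast (by omega : (0 : ℤ) ≤ round R)
  have hn : ‖toC (round R, 0)‖ = (round R : ℝ) := by
    have : toC (round R, 0) = ((round R : ℝ) : ℂ) := by
      apply Complex.ext <;> simp [toC]
    rw [this, Complex.norm_real, Real.norm_of_nonneg h0]
  exact ⟨by rw [hn]; linarith [hr.2], by rw [hn]; linarith [hr.1]⟩

theorem volume_rectG : volume rectG = ENNReal.ofReal (√8 * Real.pi) := by
  have h2 : √2 * √2 = (2 : ℝ) := Real.mul_self_sqrt (by norm_num)
  have h8 : √8 = 2 * √2 := by
    rw [show (8 : ℝ) = 2 ^ 2 * 2 by norm_num, Real.sqrt_mul (by norm_num),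
      Real.sqrt_sq (by norm_num)]
  have hp : (0 : ℝ) < √2 := by positivity
  rw [rectG, Measure.volume_eq_prod, Measure.prod_prod, Real.volume_Icc, Real.volume_Ico,
    ← ENNReal.ofReal_mul (by have : 0 < 1 / √2 := by positivity
                             linarith)]
  congr 1
  rw [h8]
  field_simp
  rw [pow_two, h2]
  ring

/-- `unifG` is the normalised Lebesgue measure of `G`. -/
theorem unifG_eq_cond : unifG = cond volume rectG := by
  rw [unifG, ProbabilityTheory.cond, volume_rectG, one_div,
    ENNReal.ofReal_inv_of_pos (by positivity)]

instance isProbabilityMeasure_unifG : IsProbabilityMeasure unifG := by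
  have hpos : (0 : ℝ) < √8 * Real.pi := by positivity
  rw [unifG_eq_cond]
  exact cond_isProbabilityMeasure_of_finite
    (by rw [volume_rectG]; simpa using hpos) (by rw [volume_rectG]; exact ENNReal.ofReal_ne_top)

instance isProbabilityMeasure_annulus (R : {R : ℝ // 0 < R}) : IsProbabilityMeasure (uniformOn (annulusPoints R)) :=
  isProbabilityMeasure_uniformOn (annulusPoints_finite R) (annulusPoints_nonempty R.2)

end CircleLattice

end

/-!
Translating by a lattice vector `v` maps the lattice to itself and moves a far point near the
direction `u`, in the shifted polar coordinates, by approximately `(⟪u, v⟫, 0)`. If `u` has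
irrational slope, the numbers `⟪u, v⟫` are dense in `ℝ`, so in a narrow cone around `u` the
asymptotic number of lattice points with `r` in an interval is invariant under translation of the
interval. Over a long interval of radii this number is close to the area, as each lattice point has
a unit cell; cutting the long interval into translates of a short one gives the correct density on
the short one. Thus the number of points in the directions `[0, t]`, as a function of `t`, has a
constant derivative off the countable set of rational slopes, and integrating it gives the number in
every sector. Taking limits along an ultrafilter in `R` makes all densities exist and be additive.
-/

namespace CircleLattice

open Set InnerProductGeometry
open scoped Real RealInnerProductSpace

section OneSidedLimits

variable {α β : Type*} [TopologicalSpace α] [LinearOrder α] [OrderTopology α] [DenselyOrdered α]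
  [TopologicalSpace β] [Preorder β] [OrderClosedTopology β] {f : α → β} {a x : α} {y : β}

theorem le_of_continuousAt_of_forall_gt [NoMaxOrder α] (hf : ContinuousAt f x)
    (h : ∀ x' > x, y ≤ f x') : y ≤ f x :=
  ge_of_tendsto (hf.mono_left nhdsWithin_le_nhds : Tendsto f (𝓝[>] x) _)
    (eventually_mem_nhdsWithin.mono h)

theorem le_of_continuousAt_of_forall_Ioo (hf : ContinuousAt f x) (ha : a < x)
    (h : ∀ x' ∈ Ioo a x, f x' ≤ y) : f x ≤ y :=
  have := nhdsLT_neBot_of_exists_lt ⟨a, ha⟩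
  le_of_tendsto (hf.mono_left nhdsWithin_le_nhds : Tendsto f (𝓝[<] x) _)
    (mem_of_superset (Ioo_mem_nhdsLT ha) h)

end OneSidedLimits

section NormExpansion

variable {E : Type*} [NormedAddCommGroup E] [InnerProductSpace ℝ E]

theorem abs_norm_add_sub_norm_sub_inner_normalize_le {z : E} (hz : z ≠ 0) (v : E) :
    |‖z + v‖ - ‖z‖ - ⟪NormedSpace.normalize z, v⟫| ≤ ‖v‖ ^ 2 / (2 * ‖z‖) := by
  have hz' : 0 < ‖z‖ := norm_pos_iff.2 hz
  have hinner : ⟪NormedSpace.normalize z, v⟫ * ‖z‖ = ⟪z, v⟫ := by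
    rw [NormedSpace.normalize, real_inner_smul_left]
    field_simp
  have hcauchy : ‖z‖ ^ 2 + ⟪z, v⟫ ≤ ‖z‖ * ‖z + v‖ := by
    simpa only [inner_add_right, real_inner_self_eq_norm_sq] using real_inner_le_norm z (z + v)
  have hamgm := two_mul_le_add_sq ‖z‖ ‖z + v‖
  rw [norm_add_sq_real] at hamgm
  rw [abs_of_nonneg, le_div_iff₀ (by positivity)]
  · nlinarith
  · refine nonneg_of_mul_nonneg_left ?_ hz'
    nlinarith

theorem norm_normalize_sub_normalize_le {z : E} (hz : z ≠ 0) (w : E) :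
    ‖NormedSpace.normalize w - NormedSpace.normalize z‖ ≤ 2 * ‖w - z‖ / ‖z‖ := by
  have hz' : 0 < ‖z‖ := norm_pos_iff.2 hz
  have hsplit : ‖z‖ • (NormedSpace.normalize w - NormedSpace.normalize z) =
      (w - z) - (‖w‖ - ‖z‖) • NormedSpace.normalize w := by
    rw [smul_sub, NormedSpace.norm_smul_normalize, sub_smul, NormedSpace.norm_smul_normalize]
    abel
  have hle : ‖NormedSpace.normalize w‖ ≤ 1 := by
    rcases eq_or_ne w 0 with rfl | hw
    · simp
    · exact (NormedSpace.norm_normalize hw).le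
  rw [le_div_iff₀ hz', mul_comm]
  calc ‖z‖ * ‖NormedSpace.normalize w - NormedSpace.normalize z‖
      = ‖(w - z) - (‖w‖ - ‖z‖) • NormedSpace.normalize w‖ := by
        rw [← hsplit, norm_smul, norm_norm]
    _ ≤ ‖w - z‖ + |‖w‖ - ‖z‖| * ‖NormedSpace.normalize w‖ := by
        exact (norm_sub_le _ _).trans_eq (by rw [norm_smul, Real.norm_eq_abs])
    _ ≤ ‖w - z‖ + ‖w - z‖ * 1 := by
        gcongr
        exact abs_norm_sub_norm_le w z
    _ = 2 * ‖w - z‖ := by ring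

end NormExpansion

theorem angle_le_pi_mul_norm_sub_div_norm {z w : ℂ} (hz : z ≠ 0) (hw : w ≠ 0) :
    angle w z ≤ π * ‖w - z‖ / ‖z‖ := by
  calc angle w z = angle (NormedSpace.normalize w) (NormedSpace.normalize z) := by
        rw [angle_normalize_left, angle_normalize_right]
    _ ≤ π / 2 * ‖NormedSpace.normalize w - NormedSpace.normalize z‖ :=
        Complex.angle_le_mul_norm_sub (NormedSpace.norm_normalize hw)
          (NormedSpace.norm_normalize hz)
    _ ≤ π / 2 * (2 * ‖w - z‖ / ‖z‖) := by
        gcongr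
        exact norm_normalize_sub_normalize_le hz w
    _ = π * ‖w - z‖ / ‖z‖ := by ring

theorem abs_norm_add_sub_norm_sub_inner_le {u z : ℂ} (hu : ‖u‖ = 1) (hz : z ≠ 0) (v : ℂ) :
    |‖z + v‖ - ‖z‖ - ⟪u, v⟫| ≤ angle z u * ‖v‖ + ‖v‖ ^ 2 / (2 * ‖z‖) := by
  have hturn : |⟪NormedSpace.normalize z, v⟫ - ⟪u, v⟫| ≤ angle z u * ‖v‖ := by
    rw [← inner_sub_left, ← angle_normalize_left]
    refine (abs_real_inner_le_norm _ _).trans ?_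
    gcongr
    exact Complex.norm_sub_le_angle (NormedSpace.norm_normalize hz) hu
  calc |‖z + v‖ - ‖z‖ - ⟪u, v⟫|
      = |(⟪NormedSpace.normalize z, v⟫ - ⟪u, v⟫) +
          (‖z + v‖ - ‖z‖ - ⟪NormedSpace.normalize z, v⟫)| := by ring_nf
    _ ≤ _ := (abs_add_le _ _).trans
        (add_le_add hturn (abs_norm_add_sub_norm_sub_inner_normalize_le hz v))

theorem angle_exp_exp_le (x y : ℝ) :
    angle (Complex.exp (x * Complex.I)) (Complex.exp (y * Complex.I)) ≤ |x - y| := by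
  rw [Complex.angle_exp_exp]
  by_cases h : x - y ∈ Ioc (-π) π
  · rw [(toIocMod_eq_self _).2 (by rwa [neg_add_eq_sub, two_mul, add_sub_cancel_right])]
  · have hmod := toIocMod_mem_Ioc Real.two_pi_pos (-π) (x - y)
    have hout : π ≤ |x - y| := by
      contrapose! h
      exact ⟨(abs_lt.1 h).1, (abs_lt.1 h).2.le⟩
    exact (abs_le.2 ⟨hmod.1.le, by linarith [hmod.2]⟩).trans hout

theorem abs_sub_lt_of_angle_exp_exp_lt {x y h : ℝ} (hxy : |x - y| ≤ 2 * π - h)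
    (hangle : angle (Complex.exp (x * Complex.I)) (Complex.exp (y * Complex.I)) < h) :
    |x - y| < h := by
  rw [Complex.angle_exp_exp, toIocMod, zsmul_eq_mul] at hangle
  set k := toIocDiv Real.two_pi_pos (-π) (x - y)
  rcases eq_or_ne k 0 with hk | hk
  · simpa [hk] using hangle
  · have hk' : (1 : ℝ) ≤ |(k : ℝ)| := by exact_mod_cast Int.one_le_abs hk
    have hturn := abs_sub_abs_le_abs_sub ((k : ℝ) * (2 * π)) (x - y)
    rw [abs_sub_comm ((k : ℝ) * (2 * π)), abs_mul, abs_of_pos Real.two_pi_pos] at hturn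
    nlinarith [Real.pi_pos]

section LatticeCells

/-- The lattice point at the lower left corner of the unit cell containing `z`. -/
noncomputable def cellPoint (z : ℂ) : ℤ × ℤ := (⌊z.re⌋, ⌊z.im⌋)

theorem measurable_cellPoint : Measurable cellPoint :=
  (Int.measurable_floor.comp Complex.measurable_re).prodMk
    (Int.measurable_floor.comp Complex.measurable_im)

theorem volume_preimage_cellPoint_singleton (p : ℤ × ℤ) : volume (cellPoint ⁻¹' {p}) = 1 := by
  have hcell : cellPoint ⁻¹' {p} = Complex.measurableEquivRealProd ⁻¹'
      (Ico (p.1 : ℝ) (p.1 + 1) ×ˢ Ico (p.2 : ℝ) (p.2 + 1)) := by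
    ext z
    simp [cellPoint, Prod.ext_iff, Int.floor_eq_iff]
  rw [hcell, Complex.volume_preserving_equiv_real_prod.measure_preimage
    (measurableSet_Ico.prod measurableSet_Ico).nullMeasurableSet, Measure.volume_eq_prod,
    Measure.prod_prod]
  simp

theorem map_cellPoint_volume : Measure.map cellPoint volume = Measure.count :=
  Measure.ext_of_singleton fun p => by
    rw [Measure.map_apply measurable_cellPoint (measurableSet_singleton p),
      volume_preimage_cellPoint_singleton, Measure.count_singleton]

theorem count_real_eq_ncard (P : Set (ℤ × ℤ)) : Measure.count.real P = P.ncard := by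
  rw [measureReal_def, Measure.count_apply P.to_countable.measurableSet, Set.ncard]
  cases P.encard <;> simp

theorem volume_real_preimage_cellPoint (P : Set (ℤ × ℤ)) :
    volume.real (cellPoint ⁻¹' P) = P.ncard := by
  rw [← count_real_eq_ncard, ← map_cellPoint_volume,
    map_measureReal_apply measurable_cellPoint P.to_countable.measurableSet]

theorem volume_preimage_cellPoint_ne_top {P : Set (ℤ × ℤ)} (hP : P.Finite) :
    volume (cellPoint ⁻¹' P) ≠ ⊤ := by
  rw [← Measure.map_apply measurable_cellPoint P.to_countable.measurableSet, map_cellPoint_volume]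
  exact (Measure.count_apply_lt_top.2 hP).ne

theorem norm_sub_toC_cellPoint_lt (z : ℂ) : ‖z - toC (cellPoint z)‖ < 2 := by
  have hre : |(z - toC (cellPoint z)).re| < 1 := by
    change |Int.fract z.re| < 1
    rw [Int.abs_fract]
    exact Int.fract_lt_one _
  have him : |(z - toC (cellPoint z)).im| < 1 := by
    change |Int.fract z.im| < 1
    rw [Int.abs_fract]
    exact Int.fract_lt_one _
  linarith [Complex.norm_le_abs_re_add_abs_im (z - toC (cellPoint z))]

end LatticeCells

section Sectors

/-- The part of `J` with distance from the circle of radius `R` around `0`, counted with sign, in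
`I`. -/
def sector (R : ℝ) (I : Set ℝ) (J : Set ℂ) : Set ℂ := {z | ‖z‖ - R ∈ I ∧ z ∈ J}

/-- The number of lattice points in a sector; it is only meaningful for `I` bounded above, as
`Set.ncard` of an infinite set is `0`. -/
noncomputable def sectorCount (R : ℝ) (I : Set ℝ) (J : Set ℂ) : ℝ := (toC ⁻¹' sector R I J).ncard

/-- The directions within `h` of `exp (m * I)`, as a closed cone; it contains `0` iff `π / 2 ≤ h`,
as angles with `0` are `π / 2`. -/
def closedCone (m h : ℝ) : Set ℂ := {z | angle z (Complex.exp (m * Complex.I)) ≤ h}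

/-- The directions within less than `h` of `exp (m * I)`. -/
def openCone (m h : ℝ) : Set ℂ := {z | angle z (Complex.exp (m * Complex.I)) < h}

/-- The points with argument, taken in `[0, 2π)`, in `[s, t)`. -/
def polarCone (s t : ℝ) : Set ℂ := {z | toIcoMod Real.two_pi_pos 0 z.arg ∈ Ico s t}

theorem openCone_subset_closedCone (m h : ℝ) : openCone m h ⊆ closedCone m h :=
  fun _ hz => le_of_lt (mem_ofPred.1 hz)

theorem toC_add (p q : ℤ × ℤ) : toC (p + q) = toC p + toC q := by
  apply Complex.ext <;> simp [toC]

theorem volume_sector_ne_top (R : ℝ) {I : Set ℝ} (hI : BddAbove I) (J : Set ℂ) :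
    volume (sector R I J) ≠ ⊤ := by
  obtain ⟨C, hC⟩ := hI
  refine ((measure_mono fun z hz => ?_).trans_lt
    (measure_closedBall_lt_top (x := (0 : ℂ)) (r := C + R))).ne
  have := hC hz.1
  rw [mem_closedBall_zero_iff]
  linarith

theorem finite_preimage_sector (R : ℝ) {I : Set ℝ} (hI : BddAbove I) (J : Set ℂ) :
    (toC ⁻¹' sector R I J).Finite := by
  obtain ⟨C, hC⟩ := hI
  rw [← Measure.count_apply_lt_top, ← map_cellPoint_volume,
    Measure.map_apply measurable_cellPoint (to_countable _).measurableSet]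
  refine (measure_mono fun z hz => ?_).trans_lt
    (volume_sector_ne_top R (bddAbove_Iic (a := C + 2)) univ).lt_top
  have := hC hz.1
  have := (abs_le.1 (abs_norm_sub_norm_le z (toC (cellPoint z)))).2
  have := norm_sub_toC_cellPoint_lt z
  exact ⟨by rw [mem_Iic]; linarith, trivial⟩

theorem sectorCount_le_of_sector_subset {R : ℝ} {I I' : Set ℝ} {J J' : Set ℂ}
    (h : sector R I J ⊆ sector R I' J') (hI' : BddAbove I') :
    sectorCount R I J ≤ sectorCount R I' J' :=
  Nat.cast_le.2 (ncard_le_ncard (preimage_mono h) (finite_preimage_sector R hI' J'))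

theorem sectorCount_nonneg (R : ℝ) (I : Set ℝ) (J : Set ℂ) : 0 ≤ sectorCount R I J :=
  Nat.cast_nonneg _

theorem eventually_lt_norm_of_norm_sub_mem {I : Set ℝ} (hI : BddBelow I) (C : ℝ) :
    ∀ᶠ R : ℝ in atTop, ∀ z : ℂ, ‖z‖ - R ∈ I → C < ‖z‖ := by
  obtain ⟨c, hc⟩ := hI
  filter_upwards [eventually_gt_atTop (C - c)] with R hR z hz
  linarith [hc hz]

theorem eventually_angle_add_lt {I : Set ℝ} (hI : BddBelow I) (V : ℝ) {η : ℝ} (hη : 0 < η) :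
    ∀ᶠ R : ℝ in atTop, ∀ z v : ℂ, ‖z‖ - R ∈ I → ‖v‖ ≤ V → angle (z + v) z < η := by
  filter_upwards [eventually_lt_norm_of_norm_sub_mem hI (max V (π * V / η))] with R hR z v hz hv
  obtain ⟨hV, hη'⟩ := max_lt_iff.1 (hR z hz)
  have hz0 : 0 < ‖z‖ := ((norm_nonneg v).trans hv).trans_lt hV
  have hadd : z + v ≠ 0 := fun h => by
    rw [eq_neg_of_add_eq_zero_left h, norm_neg] at hV
    exact hV.not_ge hv
  calc angle (z + v) z ≤ π * ‖z + v - z‖ / ‖z‖ :=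
        angle_le_pi_mul_norm_sub_div_norm (norm_pos_iff.1 hz0) hadd
    _ ≤ π * V / ‖z‖ := by
        rw [add_sub_cancel_left]
        gcongr
    _ < η := by rwa [div_lt_comm₀ hz0 hη]

theorem measurableSet_closedCone (m h : ℝ) : MeasurableSet (closedCone m h) :=
  measurableSet_le (by unfold angle; fun_prop) measurable_const

theorem volume_real_setOf_norm_mem_Icc_arg_mem {a b : ℝ} (ha : 0 < a) (hab : a ≤ b) {J : Set ℝ}
    (hJ : MeasurableSet J) :
    volume.real {z : ℂ | ‖z‖ ∈ Icc a b ∧ z.arg ∈ J} =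
      (b ^ 2 - a ^ 2) / 2 * volume.real (J ∩ Ioo (-π) π) := by
  set S := {z : ℂ | ‖z‖ ∈ Icc a b ∧ z.arg ∈ J}
  have hS : MeasurableSet S := (measurable_norm measurableSet_Icc).inter (Complex.measurable_arg hJ)
  have hbox : MeasurableSet (Icc a b ×ˢ (J ∩ Ioo (-π) π)) :=
    measurableSet_Icc.prod (hJ.inter measurableSet_Ioo)
  have hsub : Icc a b ×ˢ (J ∩ Ioo (-π) π) ⊆ polarCoord.target :=
    fun p hp => ⟨ha.trans_le hp.1.1, hp.2.2⟩
  have hmem : ∀ p ∈ polarCoord.target,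
      Complex.polarCoord.symm p ∈ S ↔ p ∈ Icc a b ×ˢ (J ∩ Ioo (-π) π) := by
    rintro ⟨r, t⟩ ⟨hr, ht⟩
    have harg : (Complex.polarCoord.symm (r, t)).arg = t := by
      simpa [Complex.polarCoord_symm_apply] using
        Complex.arg_mul_cos_add_sin_mul_I hr ⟨ht.1, ht.2.le⟩
    have hnorm : ‖Complex.polarCoord.symm (r, t)‖ = r := by
      rw [Complex.norm_polarCoord_symm, abs_of_pos hr]
    rw [mem_prod, mem_inter_iff, and_iff_left ht]
    change _ ∈ Icc a b ∧ _ ∈ J ↔ _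
    rw [hnorm, harg]
  calc volume.real S
      = ∫ p in polarCoord.target, p.1 • S.indicator 1 (Complex.polarCoord.symm p) := by
        rw [Complex.integral_comp_polarCoord_symm (S.indicator (1 : ℂ → ℝ)),
          integral_indicator_one hS]
    _ = ∫ p in polarCoord.target, (Icc a b ×ˢ (J ∩ Ioo (-π) π)).indicator (fun p => p.1 * 1) p :=
        setIntegral_congr_fun polarCoord.open_target.measurableSet fun p hp => by
          by_cases hpS : Complex.polarCoord.symm p ∈ S
          · rw [indicator_of_mem hpS, indicator_of_mem ((hmem p hp).1 hpS)]
            rfl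
          · rw [indicator_of_notMem hpS, indicator_of_notMem (mt (hmem p hp).2 hpS), smul_zero]
    _ = ∫ p in Icc a b ×ˢ (J ∩ Ioo (-π) π), p.1 * 1 := by
        rw [setIntegral_indicator hbox, inter_eq_self_of_subset_right hsub]
    _ = (∫ r in Icc a b, r) * ∫ _ in J ∩ Ioo (-π) π, (1 : ℝ) := by
        rw [Measure.volume_eq_prod, setIntegral_prod_mul (fun r : ℝ => r) (fun _ : ℝ => (1 : ℝ))]
    _ = (b ^ 2 - a ^ 2) / 2 * volume.real (J ∩ Ioo (-π) π) := by
        rw [integral_Icc_eq_integral_Ioc, ← intervalIntegral.integral_of_le hab, integral_id]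
        simp

theorem volume_real_sector_closedCone {R c d h : ℝ} (m : ℝ) (hc : 0 < R + c) (hcd : c ≤ d)
    (hh : 0 ≤ h) :
    volume.real (sector R (Icc c d) (closedCone m h)) =
      ((R + d) ^ 2 - (R + c) ^ 2) / 2 * (2 * min h π) := by
  have hset : rotation (Circle.exp m) ⁻¹' sector R (Icc c d) (closedCone m h) =
      {z : ℂ | ‖z‖ ∈ Icc (R + c) (R + d) ∧ z.arg ∈ Icc (-h) h} := by
    ext z
    have hexp := Complex.exp_ne_zero (m * Complex.I)
    have hrot : angle (Complex.exp (m * Complex.I) * z) (Complex.exp (m * Complex.I)) =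
        angle z 1 := by
      simpa only [mul_one] using Complex.angle_mul_left hexp z 1
    have hnorm : ‖Complex.exp (m * Complex.I) * z‖ = ‖z‖ := by
      rw [norm_mul, Complex.norm_exp_ofReal_mul_I, one_mul]
    simp only [sector, closedCone, mem_preimage, mem_ofPred_eq, rotation_apply, Circle.coe_exp,
      hrot, hnorm, mem_Icc, le_sub_iff_add_le', sub_le_iff_le_add']
    refine and_congr_right fun hz => ?_
    rw [Complex.angle_one_right (norm_pos_iff.1 (hc.trans_le hz.1)), abs_le]
  have hmeas : MeasurableSet (sector R (Icc c d) (closedCone m h)) :=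
    ((measurable_norm.sub_const R) measurableSet_Icc).inter (measurableSet_closedCone m h)
  have hangle : volume.real (Icc (-h) h ∩ Ioo (-π) π) = 2 * min h π := by
    rw [measureReal_congr ((ae_eq_refl _).inter Ioo_ae_eq_Icc), Icc_inter_Icc,
      max_neg_neg, Real.volume_real_Icc_of_le (neg_le_self (le_min hh Real.pi_pos.le)),
      sub_neg_eq_add, two_mul]
  rw [measureReal_def, ← (rotation (Circle.exp m)).measurePreserving.measure_preimage
    hmeas.nullMeasurableSet, ← measureReal_def, hset,
    volume_real_setOf_norm_mem_Icc_arg_mem hc (by linarith) measurableSet_Icc, hangle]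

theorem tendsto_volume_real_sector_closedCone_div {c d h : ℝ} (m : ℝ) (hcd : c ≤ d) (hh : 0 ≤ h) :
    Tendsto (fun R => volume.real (sector R (Icc c d) (closedCone m h)) / R) atTop
      (𝓝 ((d - c) * (2 * min h π))) := by
  have hlim : Tendsto (fun R : ℝ => (d - c) * (2 * min h π) +
      (d ^ 2 - c ^ 2) / 2 * (2 * min h π) / R) atTop (𝓝 ((d - c) * (2 * min h π))) := by
    simpa only [add_zero, id_eq] using (tendsto_const_nhds (x := (d - c) * (2 * min h π))).add
      (tendsto_id.const_div_atTop ((d ^ 2 - c ^ 2) / 2 * (2 * min h π)))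
  refine hlim.congr' ?_
  filter_upwards [eventually_gt_atTop (-c), eventually_gt_atTop 0] with R hc hR
  rw [volume_real_sector_closedCone m (by linarith) hcd hh]
  field_simp
  ring

theorem eventually_sectorCount_closedCone_le (c d m : ℝ) {h h' : ℝ} (hh : h < h') :
    ∀ᶠ R : ℝ in atTop, sectorCount R (Icc c d) (closedCone m h) ≤
      volume.real (sector R (Icc (c - 2) (d + 2)) (closedCone m h')) := by
  filter_upwards [eventually_angle_add_lt (bddBelow_Icc (a := d) (b := c)) 2 (sub_pos.2 hh)]
    with R hR
  rw [sectorCount, ← volume_real_preimage_cellPoint]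
  refine measureReal_mono (fun z hz => ?_) (volume_sector_ne_top R bddAbove_Icc _)
  obtain ⟨hnorm, hangle⟩ := hz
  have hcell := norm_sub_toC_cellPoint_lt z
  have hclose := abs_lt.1 ((abs_norm_sub_norm_le z (toC (cellPoint z))).trans_lt hcell)
  have hturn := hR _ _ hnorm hcell.le
  rw [add_sub_cancel] at hturn
  refine ⟨⟨by linarith [hnorm.1], by linarith [hnorm.2]⟩, ?_⟩
  have htriangle := angle_le_angle_add_angle z (toC (cellPoint z)) (Complex.exp (m * Complex.I))
  exact htriangle.trans (by linarith [show angle _ _ ≤ h from hangle])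

theorem eventually_le_sectorCount_openCone (c d m : ℝ) {h h' : ℝ} (hh : h < h') :
    ∀ᶠ R : ℝ in atTop, volume.real (sector R (Icc (c + 2) (d - 2)) (closedCone m h)) ≤
      sectorCount R (Ioo c d) (openCone m h') := by
  filter_upwards [eventually_angle_add_lt (bddBelow_Icc (a := d - 2) (b := c + 2)) 2
    (sub_pos.2 hh)] with R hR
  rw [sectorCount, ← volume_real_preimage_cellPoint]
  refine measureReal_mono (fun z hz => ?_) ?_
  · obtain ⟨hnorm, hangle⟩ := hz
    have hcell := norm_sub_toC_cellPoint_lt z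
    rw [norm_sub_rev] at hcell
    have hclose := abs_lt.1 ((abs_norm_sub_norm_le (toC (cellPoint z)) z).trans_lt hcell)
    have hturn := hR _ _ hnorm hcell.le
    rw [add_sub_cancel] at hturn
    refine ⟨⟨by linarith [hnorm.1], by linarith [hnorm.2]⟩, ?_⟩
    have htriangle := angle_le_angle_add_angle (toC (cellPoint z)) z (Complex.exp (m * Complex.I))
    exact htriangle.trans_lt (by linarith [show angle _ _ ≤ h from hangle])
  · exact volume_preimage_cellPoint_ne_top (finite_preimage_sector R bddAbove_Ioo _)

end Sectors

section Density

theorem exists_eventually_sectorCount_div_le {I : Set ℝ} (hI : Bornology.IsBounded I) (J : Set ℂ) :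
    ∃ C : ℝ, ∀ᶠ R : ℝ in atTop, sectorCount R I J / R ≤ C := by
  obtain ⟨r, hr, hIr⟩ := hI.subset_closedBall_lt 0 0
  rw [Real.closedBall_eq_Icc, zero_sub, zero_add] at hIr
  have hbound := (tendsto_volume_real_sector_closedCone_div (c := -r - 2) (d := r + 2) 0
    (by linarith) (h := π + 1) (by positivity)).eventually_le_const (lt_add_one _)
  refine ⟨(r + 2 - (-r - 2)) * (2 * min (π + 1) π) + 1, ?_⟩
  filter_upwards [hbound, eventually_gt_atTop 0,
    eventually_sectorCount_closedCone_le (-r) r 0 (lt_add_one π)] with R hR hpos hcount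
  refine le_trans ?_ hR
  gcongr
  exact (sectorCount_le_of_sector_subset (fun z hz => ⟨hIr hz.1, angle_le_pi _ _⟩)
    bddAbove_Icc).trans hcount

/-- The number of lattice points in the sectors of radius `R` and shape `I`, `J`, per unit of `R`,
in the limit along the ultrafilter `U`. For `U ≤ atTop` and `I` bounded the limit exists. -/
noncomputable def density (U : Ultrafilter ℝ) (I : Set ℝ) (J : Set ℂ) : ℝ :=
  limUnder (U : Filter ℝ) fun R => sectorCount R I J / R

variable {U : Ultrafilter ℝ} {I I' : Set ℝ} {J J' : Set ℂ}

theorem tendsto_density (hU : (U : Filter ℝ) ≤ atTop) (hI : Bornology.IsBounded I) (J : Set ℂ) :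
    Tendsto (fun R => sectorCount R I J / R) U (𝓝 (density U I J)) := by
  obtain ⟨C, hC⟩ := exists_eventually_sectorCount_div_le hI J
  have hmem : ∀ᶠ R : ℝ in U, sectorCount R I J / R ∈ Icc 0 C := by
    filter_upwards [hU hC, hU (eventually_ge_atTop 0)] with R hR hpos
    exact ⟨div_nonneg (sectorCount_nonneg R I J) hpos, hR⟩
  obtain ⟨x, -, hx⟩ := isCompact_Icc.ultrafilter_le_nhds
    (U.map fun R => sectorCount R I J / R) (le_principal_iff.2 hmem)
  exact tendsto_nhds_limUnder ⟨x, hx⟩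

theorem density_nonneg (hU : (U : Filter ℝ) ≤ atTop) (hI : Bornology.IsBounded I) (J : Set ℂ) :
    0 ≤ density U I J := by
  refine ge_of_tendsto (tendsto_density hU hI J) ?_
  filter_upwards [hU (eventually_ge_atTop 0)] with R hR
  exact div_nonneg (sectorCount_nonneg R I J) hR

theorem density_le_density (hU : (U : Filter ℝ) ≤ atTop) (hI : Bornology.IsBounded I)
    (hI' : Bornology.IsBounded I')
    (h : ∀ᶠ R : ℝ in atTop, sectorCount R I J ≤ sectorCount R I' J') :
    density U I J ≤ density U I' J' := by
  refine le_of_tendsto_of_tendsto (tendsto_density hU hI J) (tendsto_density hU hI' J') ?_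
  filter_upwards [hU h, hU (eventually_ge_atTop 0)] with R hR hpos
  gcongr

theorem density_mono (hU : (U : Filter ℝ) ≤ atTop) (hI' : Bornology.IsBounded I') (hI : I ⊆ I')
    (hJ : J \ {0} ⊆ J') : density U I J ≤ density U I' J' := by
  refine density_le_density hU (hI'.subset hI) hI' ?_
  filter_upwards [eventually_lt_norm_of_norm_sub_mem (hI'.subset hI).bddBelow 0] with R hR
  exact sectorCount_le_of_sector_subset
    (fun z hz => ⟨hI hz.1, hJ ⟨hz.2, norm_pos_iff.1 (hR z hz.1)⟩⟩) hI'.bddAbove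

theorem density_empty_left (hU : (U : Filter ℝ) ≤ atTop) (J : Set ℂ) : density U ∅ J = 0 :=
  tendsto_nhds_unique (tendsto_density hU Bornology.isBounded_empty J)
    (by simp [sectorCount, sector])

theorem density_empty_right (hU : (U : Filter ℝ) ≤ atTop) (hI : Bornology.IsBounded I) :
    density U I ∅ = 0 :=
  tendsto_nhds_unique (tendsto_density hU hI ∅) (by simp [sectorCount, sector])

theorem density_eq_add (hU : (U : Filter ℝ) ≤ atTop) {I₁ I₂ : Set ℝ} {J₁ J₂ : Set ℂ}
    (hI : Bornology.IsBounded I) (hI₁ : Bornology.IsBounded I₁) (hI₂ : Bornology.IsBounded I₂)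
    (hunion : ∀ R, sector R I J = sector R I₁ J₁ ∪ sector R I₂ J₂)
    (hdisj : ∀ R, Disjoint (sector R I₁ J₁) (sector R I₂ J₂)) :
    density U I J = density U I₁ J₁ + density U I₂ J₂ := by
  refine tendsto_nhds_unique (tendsto_density hU hI J)
    (((tendsto_density hU hI₁ J₁).add (tendsto_density hU hI₂ J₂)).congr fun R => ?_)
  rw [← add_div, sectorCount, sectorCount, sectorCount, hunion, preimage_union,
    ncard_union_eq ((hdisj R).preimage _) (finite_preimage_sector R hI₁.bddAbove J₁)
      (finite_preimage_sector R hI₂.bddAbove J₂), Nat.cast_add]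

theorem density_union_left (hU : (U : Filter ℝ) ≤ atTop) (hI : Bornology.IsBounded I)
    (hI' : Bornology.IsBounded I') (hdisj : Disjoint I I') (J : Set ℂ) :
    density U (I ∪ I') J = density U I J + density U I' J :=
  density_eq_add hU (hI.union hI') hI hI' (fun _ => ext fun _ => or_and_right)
    fun _ => disjoint_left.2 fun _ hz hz' => disjoint_left.1 hdisj hz.1 hz'.1

theorem density_union_right (hU : (U : Filter ℝ) ≤ atTop) (hI : Bornology.IsBounded I)
    (hdisj : Disjoint J J') : density U I (J ∪ J') = density U I J + density U I J' :=
  density_eq_add hU hI hI hI (fun _ => ext fun _ => and_or_left)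
    fun _ => disjoint_left.2 fun _ hz hz' => disjoint_left.1 hdisj hz.2 hz'.2

theorem sum_density_Ico (hU : (U : Filter ℝ) ≤ atTop) (x : ℝ) {l : ℝ} (hl : 0 ≤ l) (J : Set ℂ)
    (n : ℕ) : ∑ k ∈ Finset.range n, density U (Ico (x + k * l) (x + (k + 1) * l)) J =
      density U (Ico x (x + n * l)) J := by
  induction n with
  | zero => simp [density_empty_left hU]
  | succ n ih =>
    have hnl : 0 ≤ n * l := by positivity
    rw [Finset.sum_range_succ, ih, ← density_union_left hU (Metric.isBounded_Ico _ _)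
      (Metric.isBounded_Ico _ _) (Ico_disjoint_Ico_same), Ico_union_Ico_eq_Ico (by linarith)
      (by linarith)]
    push_cast
    rfl

theorem mul_density_le_density_Ico (hU : (U : Filter ℝ) ≤ atTop) {x l : ℝ} (hl : 0 ≤ l) {n : ℕ}
    (h : ∀ k ∈ Finset.range n,
      density U I J ≤ density U (Ico (x + k * l) (x + (k + 1) * l)) J') :
    n * density U I J ≤ density U (Ico x (x + n * l)) J' := by
  simpa only [Finset.card_range, nsmul_eq_mul, sum_density_Ico hU x hl] using
    Finset.card_nsmul_le_sum _ _ _ h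

theorem density_Ico_le_mul_density (hU : (U : Filter ℝ) ≤ atTop) {x l : ℝ} (hl : 0 ≤ l) {n : ℕ}
    (h : ∀ k ∈ Finset.range n,
      density U (Ico (x + k * l) (x + (k + 1) * l)) J ≤ density U I' J') :
    density U (Ico x (x + n * l)) J ≤ n * density U I' J' := by
  simpa only [Finset.card_range, nsmul_eq_mul, sum_density_Ico hU x hl] using
    Finset.sum_le_card_nsmul _ _ _ h

theorem density_closedCone_le (hU : (U : Filter ℝ) ≤ atTop) {c d h : ℝ} (m : ℝ) (hcd : c ≤ d)
    (hh : 0 ≤ h) : density U (Icc c d) (closedCone m h) ≤ (d - c + 4) * (2 * h) := by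
  have hwiden : ∀ h' > h, density U (Icc c d) (closedCone m h) ≤ (d - c + 4) * (2 * h') := by
    intro h' hh'
    refine (le_of_tendsto_of_tendsto (tendsto_density hU (Metric.isBounded_Icc c d) _)
      ((tendsto_volume_real_sector_closedCone_div (c := c - 2) (d := d + 2) m (by linarith)
        (hh.trans hh'.le)).mono_left hU) ?_).trans ?_
    · filter_upwards [hU (eventually_sectorCount_closedCone_le c d m hh'),
        hU (eventually_ge_atTop 0)] with R hR hpos
      gcongr
    · rw [show d + 2 - (c - 2) = d - c + 4 by ring]
      gcongr
      exact min_le_left _ _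
  exact le_of_continuousAt_of_forall_gt (f := fun h => (d - c + 4) * (2 * h)) (by fun_prop) hwiden

theorem le_density_openCone (hU : (U : Filter ℝ) ≤ atTop) {c d h : ℝ} (m : ℝ) (hh : 0 < h)
    (hπ : h ≤ π) : (d - c - 4) * (2 * h) ≤ density U (Ioo c d) (openCone m h) := by
  have hbdd := Metric.isBounded_Ioo c d
  rcases le_total (d - c - 4) 0 with hcd | hcd
  · exact (mul_nonpos_of_nonpos_of_nonneg hcd (by positivity)).trans (density_nonneg hU hbdd _)
  have hnarrow : ∀ h' ∈ Ioo 0 h,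
      (d - c - 4) * (2 * h') ≤ density U (Ioo c d) (openCone m h) := by
    rintro h' ⟨hh', hlt⟩
    have hvol := tendsto_volume_real_sector_closedCone_div (c := c + 2) (d := d - 2) m
      (by linarith) hh'.le
    rw [min_eq_left (hlt.le.trans hπ), show d - 2 - (c + 2) = d - c - 4 by ring] at hvol
    refine le_of_tendsto_of_tendsto (hvol.mono_left hU) (tendsto_density hU hbdd _) ?_
    filter_upwards [hU (eventually_le_sectorCount_openCone c d m hlt),
      hU (eventually_ge_atTop 0)] with R hR hpos
    gcongr
  exact le_of_continuousAt_of_forall_Ioo (f := fun h => (d - c - 4) * (2 * h)) (by fun_prop) hh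
    hnarrow

end Density

section Shift

variable {U : Ultrafilter ℝ}

theorem density_closedCone_le_of_shift (hU : (U : Filter ℝ) ≤ atTop) {x τ η δ m h h' : ℝ}
    {v : ℤ × ℤ} (hv : |⟪Complex.exp (x * Complex.I), toC v⟫ - τ| + δ * ‖toC v‖ < η)
    (hδ : |m - x| + h ≤ δ) (hh : h < h') (c d : ℝ) :
    density U (Icc c d) (closedCone m h) ≤
      density U (Ioo (c + τ - η) (d + τ + η)) (openCone m h') := by
  set u := Complex.exp (x * Complex.I)
  set κ := η - (|⟪u, toC v⟫ - τ| + δ * ‖toC v‖)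
  have hκ : 0 < κ := sub_pos.2 hv
  refine density_le_density hU (Metric.isBounded_Icc _ _) (Metric.isBounded_Ioo _ _) ?_
  filter_upwards [eventually_angle_add_lt (bddBelow_Icc (a := d) (b := c)) ‖toC v‖ (sub_pos.2 hh),
    eventually_lt_norm_of_norm_sub_mem (bddBelow_Icc (a := d) (b := c))
      (max 0 (‖toC v‖ ^ 2 / (2 * κ)))] with R hturn hfar
  refine Nat.cast_le.2 (ncard_le_ncard_of_injOn (fun p => p + v) ?_ (add_left_injective v).injOn
    (finite_preimage_sector R bddAbove_Ioo _))
  rintro p ⟨hnorm, hangle : angle _ _ ≤ h⟩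
  obtain ⟨hpos, hfar⟩ := max_lt_iff.1 (hfar _ hnorm)
  have hu : angle (toC p) u ≤ δ := by
    linarith [angle_le_angle_add_angle (toC p) (Complex.exp (m * Complex.I)) u,
      angle_exp_exp_le m x]
  have hsecond : ‖toC v‖ ^ 2 / (2 * ‖toC p‖) < κ := by
    rw [div_lt_iff₀ (mul_pos two_pos hκ)] at hfar
    rw [div_lt_iff₀ (mul_pos two_pos hpos)]
    linarith
  have hfirst : angle (toC p) u * ‖toC v‖ ≤ δ * ‖toC v‖ := by gcongr
  have hshift := abs_norm_add_sub_norm_sub_inner_le (Complex.norm_exp_ofReal_mul_I x)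
    (norm_pos_iff.1 hpos) (toC v)
  have hradial : |‖toC p + toC v‖ - ‖toC p‖ - τ| < η := by
    linarith [abs_sub_le (‖toC p + toC v‖ - ‖toC p‖) ⟪u, toC v⟫ τ]
  have hmove := abs_lt.1 hradial
  simp only [mem_preimage, toC_add]
  refine ⟨⟨by linarith [hnorm.1], by linarith [hnorm.2]⟩, ?_⟩
  refine (angle_le_angle_add_angle _ (toC p) _).trans_lt ?_
  linarith [hturn _ _ hnorm le_rfl]

theorem exists_abs_inner_toC_sub_lt {x : ℝ} (hx : Irrational (Real.cos x / Real.sin x)) (τ : ℝ)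
    {η : ℝ} (hη : 0 < η) :
    ∃ v : ℤ × ℤ, |⟪Complex.exp (x * Complex.I), toC v⟫ - τ| < η := by
  obtain ⟨y, hy, hyτ⟩ := (dense_addSubgroupClosure_pair_iff.2 hx).exists_dist_lt τ hη
  obtain ⟨p, q, rfl⟩ := AddSubgroup.mem_closure_pair.1 hy
  refine ⟨(p, q), ?_⟩
  have hinner : ⟪Complex.exp (x * Complex.I), toC (p, q)⟫ = p * Real.cos x + q * Real.sin x := by
    simp [Complex.inner, toC, Complex.exp_ofReal_mul_I_re, Complex.exp_ofReal_mul_I_im]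
  rw [hinner, abs_sub_comm, ← Real.dist_eq]
  simpa only [zsmul_eq_mul] using hyτ

theorem eventually_density_closedCone_le_of_irrational (hU : (U : Filter ℝ) ≤ atTop) {x : ℝ}
    (hx : Irrational (Real.cos x / Real.sin x)) (τ : ℝ) {η : ℝ} (hη : 0 < η) :
    ∀ᶠ δ in 𝓝[>] (0 : ℝ), ∀ m h h' : ℝ, |m - x| + h ≤ δ → h < h' → ∀ c d : ℝ,
      density U (Icc c d) (closedCone m h) ≤
        density U (Ioo (c + τ - η) (d + τ + η)) (openCone m h') := by
  obtain ⟨v, hv⟩ := exists_abs_inner_toC_sub_lt hx τ hη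
  set e := |⟪Complex.exp (x * Complex.I), toC v⟫ - τ|
  have hlim : Tendsto (fun δ : ℝ => e + δ * ‖toC v‖) (𝓝 0) (𝓝 (e + 0 * ‖toC v‖)) :=
    Continuous.tendsto (by fun_prop) 0
  rw [zero_mul, add_zero] at hlim
  filter_upwards [nhdsWithin_le_nhds (hlim.eventually_lt_const hv)] with δ hδ m h h' hm hh c d
  exact density_closedCone_le_of_shift hU hδ hm hh c d

theorem exists_density_closedCone_le (hU : (U : Filter ℝ) ≤ atTop) {x : ℝ}
    (hx : Irrational (Real.cos x / Real.sin x)) {a b ε : ℝ} (hab : a ≤ b) (hε : 0 < ε) :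
    ∃ δ > 0, ∀ m h : ℝ, 0 ≤ h → |m - x| + h ≤ δ →
      density U (Icc a b) (closedCone m h) ≤ (b - a + ε) * (2 * h) := by
  obtain ⟨n, hn⟩ := exists_nat_gt (8 / ε)
  have hn0 : (0 : ℝ) < n := lt_trans (by positivity) hn
  rw [div_lt_iff₀ hε] at hn
  set l := b - a + ε / 2 with hl_def
  have hl : 0 < l := by positivity
  obtain ⟨δ, hshift, hδ⟩ := (((eventually_all_finset (Finset.range n)).2 fun k _ =>
    eventually_density_closedCone_le_of_irrational hU hx (k * l)
      (by positivity : 0 < ε / 4)).and self_mem_nhdsWithin).exists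
  refine ⟨δ, hδ, fun m h hh hm => ?_⟩
  have hwiden : ∀ h' > h,
      n * density U (Icc a b) (closedCone m h) ≤ (n * l + 4) * (2 * h') := by
    intro h' hh'
    have htiles := mul_density_le_density_Ico hU (x := a - ε / 4) hl.le fun k hk =>
      (hshift k hk m h h' hm hh' a b).trans
        (density_mono hU (Metric.isBounded_Ico _ _) (Ioo_subset_Ico_self.trans
          (Ico_subset_Ico (by linarith) (by linarith)))
          (sdiff_subset.trans (openCone_subset_closedCone m h')))
    have hcoarse := density_closedCone_le hU m (le_add_of_nonneg_right (a := a - ε / 4)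
      (by positivity : 0 ≤ n * l)) (hh.trans hh'.le)
    rw [add_sub_cancel_left] at hcoarse
    exact htiles.trans ((density_mono hU (Metric.isBounded_Icc _ _) Ico_subset_Icc_self
      sdiff_subset).trans hcoarse)
  have hlimit : n * density U (Icc a b) (closedCone m h) ≤ (n * l + 4) * (2 * h) :=
    le_of_continuousAt_of_forall_gt (f := fun h => (n * l + 4) * (2 * h)) (by fun_prop) hwiden
  have hslack : n * l + 4 ≤ n * (b - a + ε) := by
    rw [hl_def]
    linarith
  refine le_of_mul_le_mul_left (hlimit.trans ?_) hn0
  rw [← mul_assoc (n : ℝ)]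
  exact mul_le_mul_of_nonneg_right hslack (by positivity)

theorem exists_le_density_openCone (hU : (U : Filter ℝ) ≤ atTop) {x : ℝ}
    (hx : Irrational (Real.cos x / Real.sin x)) (a b : ℝ) {ε : ℝ} (hε : 0 < ε) :
    ∃ δ > 0, ∀ m h : ℝ, 0 < h → |m - x| + h ≤ δ →
      (b - a - ε) * (2 * h) ≤ density U (Ioo a b) (openCone m h) := by
  rcases le_total (b - a - ε) 0 with hab | hab
  · exact ⟨1, one_pos, fun m h hh _ => (mul_nonpos_of_nonpos_of_nonneg hab (by positivity)).trans
      (density_nonneg hU (Metric.isBounded_Ioo _ _) _)⟩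
  obtain ⟨n, hn⟩ := exists_nat_gt (8 / ε)
  have hn0 : (0 : ℝ) < n := lt_trans (by positivity) hn
  rw [div_lt_iff₀ hε] at hn
  set l := b - a - ε / 2 with hl_def
  have hl : 0 < l := by linarith
  obtain ⟨δ, hshift, hδ, hδπ⟩ := (((eventually_all_finset (Finset.range n)).2 fun k _ =>
    eventually_density_closedCone_le_of_irrational hU hx (-(k * l))
      (by positivity : 0 < ε / 4)).and (Ioo_mem_nhdsGT Real.pi_pos)).exists
  refine ⟨δ, hδ, fun m h hh hm => ?_⟩
  have hnarrow : ∀ h' ∈ Ioo 0 h,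
      (n * l - 4) * (2 * h') ≤ n * density U (Ioo a b) (openCone m h) := by
    rintro h' ⟨hh'0, hh'⟩
    have htiles := density_Ico_le_mul_density hU (x := a + ε / 4) hl.le fun k hk =>
      (density_mono hU (Metric.isBounded_Icc _ _) Ico_subset_Icc_self sdiff_subset).trans
        ((hshift k hk m h' h (by linarith) hh' _ _).trans (density_mono hU
          (Metric.isBounded_Ioo a b) (Ioo_subset_Ioo (by linarith) (by linarith)) sdiff_subset))
    have hcoarse := le_density_openCone hU (c := a + ε / 4) (d := a + ε / 4 + n * l) m hh'0
      (by linarith [abs_nonneg (m - x)])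
    rw [add_sub_cancel_left] at hcoarse
    exact hcoarse.trans ((density_mono hU (Metric.isBounded_Ico _ _) Ioo_subset_Ico_self
      (sdiff_subset.trans (openCone_subset_closedCone m h'))).trans htiles)
  have hlimit : (n * l - 4) * (2 * h) ≤ n * density U (Ioo a b) (openCone m h) :=
    le_of_continuousAt_of_forall_Ioo (f := fun h => (n * l - 4) * (2 * h)) (by fun_prop) hh
      hnarrow
  have hslack : n * (b - a - ε) ≤ n * l - 4 := by
    rw [hl_def]
    linarith
  refine le_of_mul_le_mul_left (le_trans ?_ hlimit) hn0
  rw [← mul_assoc (n : ℝ)]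
  exact mul_le_mul_of_nonneg_right hslack (by positivity)

end Shift

section PolarCones

theorem exp_toIcoMod_mul_I (x : ℝ) :
    Complex.exp (toIcoMod Real.two_pi_pos 0 x * Complex.I) = Complex.exp (x * Complex.I) := by
  simpa only [Circle.coe_exp, toIcoMod] using congrArg ((↑) : Circle → ℂ)
    (Circle.periodic_exp.sub_zsmul_eq (x := x) (toIcoDiv Real.two_pi_pos 0 x))

theorem angle_exp_toIcoMod_arg {z : ℂ} (hz : z ≠ 0) (w : ℂ) :
    angle (Complex.exp (toIcoMod Real.two_pi_pos 0 z.arg * Complex.I)) w = angle z w := by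
  rw [exp_toIcoMod_mul_I]
  conv_rhs => rw [← Complex.norm_mul_exp_arg_mul_I z, ← Complex.real_smul]
  rw [angle_smul_left_of_pos _ _ (norm_pos_iff.2 hz)]

theorem openCone_diff_zero_subset_polarCone {s t : ℝ} (hs : 0 ≤ s) (ht : t ≤ 2 * π) :
    openCone ((s + t) / 2) ((t - s) / 2) \ {0} ⊆ polarCone s t := by
  rintro z ⟨hz, hz0⟩
  obtain ⟨hφ0, hφ⟩ := toIcoMod_mem_Ico Real.two_pi_pos 0 z.arg
  have hfar : |toIcoMod Real.two_pi_pos 0 z.arg - (s + t) / 2| ≤ 2 * π - (t - s) / 2 :=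
    abs_le.2 ⟨by linarith, by linarith⟩
  have hnear := abs_lt.1 (abs_sub_lt_of_angle_exp_exp_lt hfar
    ((angle_exp_toIcoMod_arg hz0 _).trans_lt hz))
  exact ⟨by linarith, by linarith⟩

theorem polarCone_diff_zero_subset_closedCone (s t : ℝ) :
    polarCone s t \ {0} ⊆ closedCone ((s + t) / 2) ((t - s) / 2) := by
  rintro z ⟨⟨hs, ht⟩, hz0⟩
  change angle z _ ≤ _
  rw [← angle_exp_toIcoMod_arg hz0]
  exact (angle_exp_exp_le _ _).trans (abs_le.2 ⟨by linarith, by linarith⟩)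

theorem polarCone_eq_empty {s t : ℝ} (h : t ≤ s) : polarCone s t = ∅ :=
  (congrArg _ (Ico_eq_empty_of_le h)).trans preimage_empty

theorem polarCone_union_polarCone {r s t : ℝ} (hrs : r ≤ s) (hst : s ≤ t) :
    polarCone r s ∪ polarCone s t = polarCone r t := by
  rw [polarCone, polarCone, polarCone, ← Ico_union_Ico_eq_Ico hrs hst]
  rfl

theorem disjoint_polarCone (r s t : ℝ) : Disjoint (polarCone r s) (polarCone s t) :=
  disjoint_left.2 fun _ h h' => h.2.not_ge h'.1

end PolarCones

section Equidistribution

variable {U : Ultrafilter ℝ} {a b : ℝ}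

theorem density_polarCone_add (hU : (U : Filter ℝ) ≤ atTop) (a b : ℝ) {r s t : ℝ} (hrs : r ≤ s)
    (hst : s ≤ t) : density U (Ioo a b) (polarCone r s) + density U (Ioo a b) (polarCone s t) =
      density U (Ioo a b) (polarCone r t) := by
  rw [← density_union_right hU (Metric.isBounded_Ioo a b) (disjoint_polarCone r s t),
    polarCone_union_polarCone hrs hst]

theorem density_polarCone_le (hU : (U : Filter ℝ) ≤ atTop) (hab : a ≤ b) {s t : ℝ} (hst : s ≤ t) :
    density U (Ioo a b) (polarCone s t) ≤ (b - a + 4) * (t - s) := by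
  refine (density_mono hU (Metric.isBounded_Icc a b) Ioo_subset_Icc_self
    (polarCone_diff_zero_subset_closedCone s t)).trans ?_
  simpa only [mul_div_cancel₀ _ (two_ne_zero' ℝ)] using
    density_closedCone_le hU ((s + t) / 2) hab (by linarith : 0 ≤ (t - s) / 2)

theorem continuousOn_density_polarCone (hU : (U : Filter ℝ) ≤ atTop) (hab : a ≤ b) (s : ℝ) :
    ContinuousOn (fun t => density U (Ioo a b) (polarCone s t)) (Ici s) := by
  refine (LipschitzOnWith.of_le_add_mul' (b - a + 4) fun t ht t' ht' => ?_).continuousOn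
  rcases le_total t t' with h | h
  · have hnonneg := density_nonneg hU (Metric.isBounded_Ioo a b) (polarCone t t')
    have : 0 ≤ (b - a + 4) * dist t t' := mul_nonneg (by linarith) dist_nonneg
    linarith [density_polarCone_add hU a b ht h]
  · rw [Real.dist_eq, abs_of_nonneg (sub_nonneg.2 h), ← density_polarCone_add hU a b ht' h]
    gcongr
    exact density_polarCone_le hU hab h

theorem exists_abs_density_polarCone_sub_le (hU : (U : Filter ℝ) ≤ atTop) (hab : a ≤ b) {x : ℝ}
    (hx : Irrational (Real.cos x / Real.sin x)) {ε : ℝ} (hε : 0 < ε) :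
    ∃ δ > 0, ∀ s t : ℝ, 0 ≤ s → t ≤ 2 * π → x ∈ Icc s t → t - s ≤ δ →
      |density U (Ioo a b) (polarCone s t) - (b - a) * (t - s)| ≤ ε * (t - s) := by
  obtain ⟨δ₁, hδ₁, hupper⟩ := exists_density_closedCone_le hU hx hab hε
  obtain ⟨δ₂, hδ₂, hlower⟩ := exists_le_density_openCone hU hx a b hε
  refine ⟨min δ₁ δ₂, lt_min hδ₁ hδ₂, fun s t hs ht hxst hδ => ?_⟩
  obtain ⟨hδ₁', hδ₂'⟩ := le_min_iff.1 hδ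
  rcases (hxst.1.trans hxst.2).eq_or_lt with rfl | hst
  · simp [polarCone_eq_empty, density_empty_right hU (Metric.isBounded_Ioo a b)]
  have hmid : |(s + t) / 2 - x| ≤ (t - s) / 2 :=
    abs_le.2 ⟨by linarith [hxst.2], by linarith [hxst.1]⟩
  have hle := (density_mono hU (Metric.isBounded_Icc a b) Ioo_subset_Icc_self
    (polarCone_diff_zero_subset_closedCone s t)).trans
    (hupper _ ((t - s) / 2) (by linarith) (by linarith))
  have hge := (hlower _ ((t - s) / 2) (by linarith) (by linarith)).trans
    (density_mono hU (Metric.isBounded_Ioo a b) subset_rfl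
      (openCone_diff_zero_subset_polarCone hs ht))
  rw [mul_div_cancel₀ _ two_ne_zero] at hle hge
  exact abs_le.2 ⟨by linarith, by linarith⟩

theorem hasDerivAt_density_polarCone (hU : (U : Filter ℝ) ≤ atTop) (hab : a ≤ b) {x : ℝ}
    (hx : Irrational (Real.cos x / Real.sin x)) (hx0 : 0 < x) (hxπ : x < 2 * π) :
    HasDerivAt (fun t => density U (Ioo a b) (polarCone 0 t)) (b - a) x := by
  rw [hasDerivAt_iff_isLittleO, Asymptotics.isLittleO_iff]
  intro ε hε
  obtain ⟨δ, hδ, hdensity⟩ := exists_abs_density_polarCone_sub_le hU hab hx hε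
  filter_upwards [Metric.closedBall_mem_nhds x hδ, eventually_gt_nhds hx0,
    eventually_lt_nhds hxπ] with y hyδ hy0 hyπ
  rw [Metric.mem_closedBall, Real.dist_eq] at hyδ
  rw [Real.norm_eq_abs, Real.norm_eq_abs, smul_eq_mul]
  rcases le_total x y with h | h
  · rw [abs_of_nonneg (sub_nonneg.2 h)] at hyδ ⊢
    have := hdensity x y hx0.le hyπ.le ⟨le_rfl, h⟩ hyδ
    rwa [← density_polarCone_add hU a b hx0.le h, add_sub_cancel_left, mul_comm (y - x)]
  · rw [abs_sub_comm, abs_of_nonneg (sub_nonneg.2 h)] at hyδ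
    have := hdensity y x hy0.le hxπ.le ⟨h, le_rfl⟩ hyδ
    rw [← density_polarCone_add hU a b hy0.le h, abs_sub_comm y, abs_of_nonneg (sub_nonneg.2 h),
      ← abs_neg]
    convert! this using 2
    ring

theorem countable_setOf_not_irrational_cot :
    {x : ℝ | ¬ Irrational (Real.cos x / Real.sin x)}.Countable := by
  have hsubset : {x : ℝ | ¬ Irrational (Real.cos x / Real.sin x)} ⊆
      (⋃ q : ℚ, range fun k : ℤ => (2 * k + 1) * π / 2 - Real.arctan q) ∪
        range fun k : ℤ => (k : ℝ) * π := by
    intro x hx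
    by_cases hsin : Real.sin x = 0
    · exact Or.inr (Real.sin_eq_zero_iff.1 hsin)
    obtain ⟨q, hq⟩ := not_not.1 hx
    have hcos : Real.cos (x + Real.arctan q) = 0 := by
      rw [Real.cos_add, Real.cos_arctan, Real.sin_arctan, (div_eq_iff hsin).1 hq.symm]
      ring
    obtain ⟨k, hk⟩ := Real.cos_eq_zero_iff.1 hcos
    exact Or.inl (mem_iUnion.2 ⟨q, k, (eq_sub_of_add_eq hk).symm⟩)
  exact ((countable_iUnion fun _ => countable_range _).union (countable_range _)).mono hsubset

theorem density_polarCone_zero (hU : (U : Filter ℝ) ≤ atTop) (hab : a ≤ b) {t : ℝ} (ht0 : 0 ≤ t)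
    (ht : t ≤ 2 * π) : density U (Ioo a b) (polarCone 0 t) = (b - a) * t := by
  have hftc := integral_eq_of_hasDerivAt_off_countable_of_le
    (fun t => density U (Ioo a b) (polarCone 0 t)) (fun _ => b - a) ht0
    countable_setOf_not_irrational_cot
    ((continuousOn_density_polarCone hU hab 0).mono Icc_subset_Ici_self)
    (fun x hx => hasDerivAt_density_polarCone hU hab (not_not.1 hx.2) hx.1.1 (hx.1.2.trans_le ht))
    intervalIntegrable_const
  rw [intervalIntegral.integral_const, polarCone_eq_empty le_rfl,
    density_empty_right hU (Metric.isBounded_Ioo a b), sub_zero, sub_zero, smul_eq_mul] at hftc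
  rw [← hftc, mul_comm]

theorem density_polarCone (hU : (U : Filter ℝ) ≤ atTop) (a b : ℝ) {s t : ℝ} (hs : 0 ≤ s)
    (ht : t ≤ 2 * π) : density U (Ioo a b) (polarCone s t) =
      volume.real (Ioo a b) * volume.real (Ico s t) := by
  rcases le_total b a with hab | hab
  · rw [Ioo_eq_empty_of_le hab, density_empty_left hU, measureReal_empty, zero_mul]
  rcases le_total t s with hst | hst
  · rw [polarCone_eq_empty hst, density_empty_right hU (Metric.isBounded_Ioo a b),
      Ico_eq_empty_of_le hst, measureReal_empty, mul_zero]
  rw [Real.volume_real_Ioo_of_le hab, Real.volume_real_Ico_of_le hst]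
  linarith [density_polarCone_add hU a b hs hst, density_polarCone_zero hU hab hs (hst.trans ht),
    density_polarCone_zero hU hab (hs.trans hst) ht]

theorem tendsto_sectorCount_polarCone_div (a b : ℝ) {s t : ℝ} (hs : 0 ≤ s) (ht : t ≤ 2 * π) :
    Tendsto (fun R => sectorCount R (Ioo a b) (polarCone s t) / R) atTop
      (𝓝 (volume.real (Ioo a b) * volume.real (Ico s t))) := by
  rw [tendsto_iff_ultrafilter]
  intro U hU
  rw [← density_polarCone hU a b hs ht]
  exact tendsto_density hU (Metric.isBounded_Ioo a b) _

end Equidistribution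

section WeakConvergence

theorem measureReal_cond {α : Type*} [MeasurableSpace α] (μ : Measure α) {s : Set α}
    (hs : MeasurableSet s) (t : Set α) : (cond μ s).real t = μ.real (s ∩ t) / μ.real s := by
  rw [measureReal_def, cond_apply hs, ENNReal.toReal_mul, ENNReal.toReal_inv, inv_mul_eq_div]
  rfl

theorem annulusPoints_eq_preimage_shiftedPolar (R : ℝ) :
    annulusPoints R = shiftedPolar R ⁻¹' (Ioo (-(1 / √2)) (1 / √2) ×ˢ Ico 0 (2 * π)) := by
  refine Subset.antisymm (fun p hp => ⟨⟨?_, ?_⟩, (shiftedPolar_mem hp).2⟩)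
    fun p hp => ⟨?_, ?_⟩
  · exact lt_sub_iff_add_lt'.2 hp.1
  · exact sub_lt_iff_lt_add'.2 hp.2
  · exact lt_sub_iff_add_lt'.1 hp.1.1
  · exact sub_lt_iff_lt_add'.1 hp.1.2

theorem uniformOn_real_preimage_shiftedPolar (R a b s t : ℝ) :
    (uniformOn (annulusPoints R)).real (shiftedPolar R ⁻¹' (Ioo a b ×ˢ Ico s t)) =
      sectorCount R (Ioo (-(1 / √2) ⊔ a) (1 / √2 ⊓ b)) (polarCone (0 ⊔ s) ((2 * π) ⊓ t)) /
        sectorCount R (Ioo (-(1 / √2)) (1 / √2)) (polarCone 0 (2 * π)) := by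
  rw [uniformOn, measureReal_cond _ (annulusPoints_finite R).measurableSet,
    annulusPoints_eq_preimage_shiftedPolar, ← preimage_inter, prod_inter_prod, Ioo_inter_Ioo,
    Ico_inter_Ico, count_real_eq_ncard, count_real_eq_ncard]
  rfl

theorem unifG_real_prod (a b s t : ℝ) :
    unifG.real (Ioo a b ×ˢ Ico s t) =
      volume.real (Ioo (-(1 / √2) ⊔ a) (1 / √2 ⊓ b)) * volume.real (Ico (0 ⊔ s) ((2 * π) ⊓ t)) /
        (volume.real (Ioo (-(1 / √2)) (1 / √2)) * volume.real (Ico 0 (2 * π))) := by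
  rw [unifG_eq_cond, rectG, measureReal_cond _ (measurableSet_Icc.prod measurableSet_Ico),
    prod_inter_prod, Measure.volume_eq_prod, measureReal_prod_prod, measureReal_prod_prod,
    ← measureReal_congr (Ioo_ae_eq_Icc (μ := volume)),
    ← measureReal_congr ((Ioo_ae_eq_Icc (μ := volume)).inter (ae_eq_refl (Ioo a b))),
    Ioo_inter_Ioo, Ico_inter_Ico]

theorem tendsto_uniformOn_real_preimage_shiftedPolar (a b s t : ℝ) :
    Tendsto (fun R => (uniformOn (annulusPoints R)).real
      (shiftedPolar R ⁻¹' (Ioo a b ×ˢ Ico s t))) atTop (𝓝 (unifG.real (Ioo a b ×ˢ Ico s t))) := by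
  have hvol : volume.real (Ioo (-(1 / √2)) (1 / √2)) * volume.real (Ico 0 (2 * π)) ≠ 0 := by
    rw [Real.volume_real_Ioo_of_le (neg_le_self (by positivity)), Real.volume_real_Ico_of_le
      Real.two_pi_pos.le, sub_neg_eq_add, sub_zero]
    positivity
  simp only [uniformOn_real_preimage_shiftedPolar, unifG_real_prod]
  refine ((tendsto_sectorCount_polarCone_div _ _ le_sup_left inf_le_left).div
    (tendsto_sectorCount_polarCone_div _ _ le_rfl le_rfl) hvol).congr' ?_
  filter_upwards [eventually_ne_atTop 0] with R hR
  exact div_div_div_cancel_right₀ hR _ _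

theorem tendsto_probabilityMeasure_of_tendsto_Ioo_prod_Ico {ι α β : Type*} {l : Filter ι}
    [l.IsCountablyGenerated] [LinearOrder α] [DenselyOrdered α] [NoMinOrder α] [NoMaxOrder α]
    [TopologicalSpace α] [OrderTopology α] [SecondCountableTopology α] [MeasurableSpace α]
    [BorelSpace α] [LinearOrder β] [DenselyOrdered β] [NoMinOrder β] [NoMaxOrder β]
    [TopologicalSpace β] [OrderTopology β] [SecondCountableTopology β] [MeasurableSpace β]
    [BorelSpace β] {μ : ι → ProbabilityMeasure (α × β)} {ν : ProbabilityMeasure (α × β)}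
    (h : ∀ a b s t, Tendsto (fun i => (μ i : Measure (α × β)).real (Ioo a b ×ˢ Ico s t)) l
      (𝓝 ((ν : Measure (α × β)).real (Ioo a b ×ˢ Ico s t)))) :
    Tendsto μ l (𝓝 ν) := by
  refine ((isPiSystem_Ioo id id).prod
    (isPiSystem_Ico id id)).tendsto_probabilityMeasure_of_tendsto_of_mem ?_ ?_ ?_
  · rintro _ ⟨_, ⟨a, b, -, rfl⟩, _, ⟨s, t, -, rfl⟩, rfl⟩
    exact measurableSet_Ioo.prod measurableSet_Ico
  · rintro u hu ⟨x, y⟩ hxy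
    obtain ⟨v, hv, w, hw, hvw⟩ := mem_nhds_prod_iff.1 (hu.mem_nhds hxy)
    obtain ⟨a, b, hx, hab⟩ := mem_nhds_iff_exists_Ioo_subset.1 hv
    obtain ⟨s, t, hy, hst⟩ := mem_nhds_iff_exists_Ioo_subset.1 hw
    obtain ⟨s', hs', hs'y⟩ := exists_between hy.1
    refine ⟨Ioo a b ×ˢ Ico s' t, ⟨_, ⟨a, b, hx.1.trans hx.2, rfl⟩, _,
      ⟨s', t, hs'y.trans hy.2, rfl⟩, rfl⟩,
      prod_mem_nhds (Ioo_mem_nhds hx.1 hx.2) (Ico_mem_nhds hs'y hy.2),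
      (prod_mono hab (subset_trans ?_ hst)).trans hvw⟩
    exact fun q hq => ⟨hs'.trans_le hq.1, hq.2⟩
  · rintro _ ⟨_, ⟨a, b, -, rfl⟩, _, ⟨s, t, -, rfl⟩, rfl⟩
    exact NNReal.tendsto_coe.1 (h a b s t)

end WeakConvergence

end CircleLattice

theorem mainTheorem11 :
    TendstoInDistribution
      (fun (R : {R : ℝ // 0 < R}) (p : ℤ × ℤ) => CircleLattice.shiftedPolar R p)
      (comap (fun R : {R : ℝ // 0 < R} => (R : ℝ)) atTop)
      (id : ℝ × ℝ → ℝ × ℝ)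
      (fun R : {R : ℝ // 0 < R} => uniformOn (CircleLattice.annulusPoints R))
      CircleLattice.unifG := by
  have hmeas : ∀ R : ℝ, Measurable (CircleLattice.shiftedPolar R) := fun R =>
    measurable_of_countable _
  refine ⟨fun R => (hmeas R).aemeasurable, aemeasurable_id,
    CircleLattice.tendsto_probabilityMeasure_of_tendsto_Ioo_prod_Ico fun a b s t => ?_⟩
  have hbox := (CircleLattice.tendsto_uniformOn_real_preimage_shiftedPolar a b s t).comp
    (tendsto_comap (f := fun R : {R : ℝ // 0 < R} => (R : ℝ)))
  simpa only [ProbabilityMeasure.coe_mk, Measure.map_id, Function.comp_def,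
    map_measureReal_apply (hmeas _) (measurableSet_Ioo.prod measurableSet_Ico)] using hbox
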